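/- Let $n\ge 1$, let $\mathcal P_n$ be the space of complex polynomials of degree at most $n$, let $D$ denote differentiation, and let $T=\alpha_0 I+\alpha_1 D+\cdots+\alpha_n D^n$ with $\alpha_0,\dots,\alpha_n\in\mathbb C$ and $\alpha_0\neq 0$. For $\alpha\in\mathbb C$ put $(S(\alpha)f)(z)=f(\alpha+z)$. For a nonzero polynomial $f$ let $Z(f)$ be its multiset of complex roots (with multiplicity), and let $$\tau(f)=\min\{|w-v| : f(w)=0,\ f'(v)=0,\ v\neq w\},$$ with the convention $\tau(f)=+\infty$ if there is no such pair $(w,v)$ (for $f$ with simple roots this happens only if $\deg f\le 1$). For finite multisets $A=\{a_1,\dots,a_m\}$ and $B=\{b_1,\dots,b_m\}$ of complex numbers of the same size let $$d_F(A,B)=\min_{\sigma}\max_{1\le k\le m}|a_k-b_{\sigma(k)}|$$ be their Fréchet distance, where $\sigma$ runs over all permutations of $\{1,\dots,m\}$ (and $d_F=0$ if $m=0$). Then for every $\varepsilon>0$ there is a constant $C_T(\varepsilon)>0$, depending only on $T$ and $\varepsilon$, such that for every nonzero $f\in\mathcal P_n$ all of whose roots are simple: if $\tau(f)>C_T(\varepsilon)$,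 then $Z(S(\alpha_1/\alpha_0)f)$ and $Z(Tf)$ have the same number of elements and $$d_F\bigl(Z(S(\alpha_1/\alpha_0)f),\,Z(Tf)\bigr)<\varepsilon .$$ In words: the roots of $Tf$ are $\varepsilon$-close, in Fréchet distance, to the roots of $f$ translated by $-\alpha_1/\alpha_0$. -/

import Mathlib

open Polynomial
open scoped ENNReal

noncomputable section

/-- The differential operator `α₀ I + α₁ D + ⋯ + αₙ Dⁿ` acting on complex polynomials
(it maps polynomials of degree at most `n` to polynomials of degree at most `n`). -/
def diffOperator (n : ℕ) (α : Fin (n + 1) → ℂ) : ℂ[X] →ₗ[ℂ] ℂ[X] :=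
  ∑ k : Fin (n + 1), α k • (Polynomial.derivative : ℂ[X] →ₗ[ℂ] ℂ[X]) ^ (k : ℕ)

/-- All roots of `f` are simple. (The zero polynomial does not satisfy this, since Mathlib gives
it multiplicity `0` at every point.) -/
def HasSimpleRoots (f : ℂ[X]) : Prop :=
  ∀ w : ℂ, f.IsRoot w → f.rootMultiplicity w = 1

/-- The set of roots of a polynomial. -/
def zeroSet (f : ℂ[X]) : Set ℂ := {w | f.IsRoot w}

/-- `τ(f)`: the minimal distance `|w - v|`, where `w` is a root of `f` and `v ≠ w` is a root of
`f'`. If `f` has at least two distinct roots then this is a minimum over a finite nonempty set; when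
there is no such pair of points the value is `∞`. -/
def rootTau (f : ℂ[X]) : ℝ≥0∞ :=
  ⨅ w ∈ zeroSet f, ⨅ v ∈ zeroSet (Polynomial.derivative f) \ {w}, ENNReal.ofReal ‖w - v‖

/-- The Fréchet distance of two `m`-tuples of complex numbers: the minimum over permutations `σ` of
the maximum over `k` of `|u k - v (σ k)|`. -/
def frechetDistTuple {m : ℕ} (u v : Fin m → ℂ) : ℝ≥0∞ :=
  ⨅ σ : Equiv.Perm (Fin m), ⨆ k : Fin m, ENNReal.ofReal ‖u k - v (σ k)‖

/-- The Fréchet distance of two finite multisets of complex numbers: the Fréchet distance of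
enumerations `u` of `A` and `v` of `B` by the same index set. For multisets of the same size
the value does not depend on the enumerations; for multisets of different sizes it is `∞`. -/
def frechetDist (A B : Multiset ℂ) : ℝ≥0∞ :=
  ⨅ (m : ℕ) (u : Fin m → ℂ) (v : Fin m → ℂ)
    (_ : (Finset.univ : Finset (Fin m)).val.map u = A)
    (_ : (Finset.univ : Finset (Fin m)).val.map v = B), frechetDistTuple u v

end

/-!
The idea is local. Suppose that every root of `f'` is at distance at least `R` from a root `w` of
`f`, with `R` large. Writing `f'(w + z) = f'(w) ∏ (1 + z / (w - v))` over the roots `v` of `f'`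
shows that the Taylor coefficients `F k` of `f` at `w` satisfy `‖F k‖ ≤ (2 ^ n / R) ‖F 1‖` for
`k ≥ 2` (`norm_coeff_taylor_mul_pow_le`, `norm_coeff_taylor_le_of_isRoot`): after division by
`f'(w)`, the translate `f(w + z)` is a small perturbation of `z`. Since `T` commutes with
translations, `(T f)(w + z) / f'(w)` is a small perturbation of `T z = α₀ z + α₁`, which vanishes
at `z = -α₁/α₀` with derivative `α₀`.

That `T f` then has a root near `a = w - α₁/α₀` needs no Rouché argument: if all roots of a
polynomial `p` of degree `d` are at distance at least `δ` from `a`, then the logarithmic derivative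
gives `δ ‖p'(a)‖ ≤ d ‖p(a)‖` (`exists_isRoot_norm_sub_lt`).

The same perturbation estimate shows that distinct roots of `f` are more than `ε` apart
(`lt_norm_sub_of_isRoot`), so that the roots of `T f` found in this way are distinct. There are
`deg f` of them and `deg (T f) ≤ deg f`, hence they are all the roots of `T f`, each simple.
-/

/-! ### Taylor coefficients at a point far from the roots -/

/-- If all the `v ∈ s` are at distance at least `R` from `w`, then in
`∏ (w - v + z) = ∏ (w - v) * ∏ (1 + z / (w - v))` the coefficient of `z ^ k` is the
elementary symmetric function of the `1 / (w - v)`, with `choose (card s) k` terms. -/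
lemma norm_coeff_taylor_prod_mul_pow_le {R : ℝ} (hR : 0 ≤ R) (w : ℂ) (s : Multiset ℂ)
    (hs : ∀ v ∈ s, R ≤ ‖w - v‖) (k : ℕ) :
    ‖(taylor w (s.map fun v => X - C v).prod).coeff k‖ * R ^ k ≤
      (s.card.choose k : ℝ) * ‖(taylor w (s.map fun v => X - C v).prod).coeff 0‖ := by
  induction s using Multiset.induction generalizing k with
  | empty =>
    cases k with
    | zero => simp
    | succ k => simp [coeff_one]
  | cons v s ih =>
    have hv : R ≤ ‖w - v‖ := hs v (Multiset.mem_cons_self v s)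
    replace ih := ih fun u hu => hs u (Multiset.mem_cons_of_mem hu)
    rw [Multiset.map_cons, Multiset.prod_cons, taylor_mul, Multiset.card_cons]
    set q := taylor w (s.map fun v => X - C v).prod
    have hX : taylor w (X - C v) = X + C (w - v) := by
      rw [map_sub, taylor_X, taylor_C, C_sub]; ring
    rw [hX, add_mul]
    cases k with
    | zero => simp
    | succ k =>
      rw [coeff_add, coeff_X_mul, coeff_C_mul, coeff_add, mul_coeff_zero, coeff_X_zero, zero_mul,
        zero_add, coeff_C_mul, norm_mul, Nat.choose_succ_succ]
      push_cast
      have h1 := ih k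
      have h2 := ih (k + 1)
      calc ‖q.coeff k + (w - v) * q.coeff (k + 1)‖ * R ^ (k + 1)
          ≤ (‖q.coeff k‖ + ‖w - v‖ * ‖q.coeff (k + 1)‖) * R ^ (k + 1) := by
            gcongr
            exact (norm_add_le _ _).trans_eq (by rw [norm_mul])
        _ = R * (‖q.coeff k‖ * R ^ k) + ‖w - v‖ * (‖q.coeff (k + 1)‖ * R ^ (k + 1)) := by ring
        _ ≤ ‖w - v‖ * ((s.card.choose k : ℝ) * ‖q.coeff 0‖) +
            ‖w - v‖ * ((s.card.choose (k + 1) : ℝ) * ‖q.coeff 0‖) := by gcongr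
        _ = _ := by ring

lemma norm_coeff_taylor_mul_pow_le {R : ℝ} (hR : 0 ≤ R) (w : ℂ) (p : ℂ[X])
    (hp : ∀ v ∈ p.roots, R ≤ ‖w - v‖) (k : ℕ) :
    ‖(taylor w p).coeff k‖ * R ^ k ≤ (p.natDegree.choose k : ℝ) * ‖p.eval w‖ := by
  have h := norm_coeff_taylor_prod_mul_pow_le hR w p.roots hp k
  have e := (IsAlgClosed.splits p).eq_prod_roots
  have hk (j : ℕ) : (taylor w p).coeff j = p.leadingCoeff *
      (taylor w (p.roots.map fun v => X - C v).prod).coeff j := by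
    conv_lhs => rw [e]
    rw [taylor_mul, taylor_C, coeff_C_mul]
  rw [IsAlgClosed.card_roots_eq_natDegree] at h
  rw [← taylor_coeff_zero, hk k, hk 0, norm_mul, norm_mul]
  have := mul_le_mul_of_nonneg_left h (norm_nonneg p.leadingCoeff)
  linarith

/-- A lower bound for the logarithmic derivative at `a` produces a root near `a`. -/
lemma exists_isRoot_norm_sub_lt {p : ℂ[X]} {a : ℂ} {δ : ℝ} (hδ : 0 ≤ δ)
    (h : p.natDegree * ‖p.eval a‖ < δ * ‖p.derivative.eval a‖) :
    ∃ z, p.IsRoot z ∧ ‖a - z‖ < δ := by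
  by_contra! H
  have := norm_coeff_taylor_mul_pow_le hδ a p (fun v hv => H v (isRoot_of_mem_roots hv)) 1
  rw [taylor_coeff_one, pow_one, Nat.choose_one_right] at this
  linarith

/-! ### Taylor expansion at a simple root far from the critical points -/

/-- A simple root of `f` is not a root of `f'`. -/
lemma HasSimpleRoots.eval_derivative_ne_zero {f : ℂ[X]} (hf : HasSimpleRoots f) {w : ℂ}
    (hw : f.IsRoot w) : f.derivative.eval w ≠ 0 := by
  intro h0
  have h1 := hf w hw
  have hf0 : f ≠ 0 := by
    rintro rfl
    simp at h1
  have := (one_lt_rootMultiplicity_iff_isRoot hf0).2 ⟨hw, h0⟩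
  omega

lemma HasSimpleRoots.ne_zero {f : ℂ[X]} (hf : HasSimpleRoots f) : f ≠ 0 := by
  rintro rfl
  have := hf 0 (by simp)
  simp at this

lemma HasSimpleRoots.nodup_roots {f : ℂ[X]} (hf : HasSimpleRoots f) : f.roots.Nodup := by
  rw [Multiset.nodup_iff_count_le_one]
  intro w
  rw [count_roots]
  by_cases hw : f.IsRoot w
  · exact (hf w hw).le
  · rw [rootMultiplicity_eq_zero hw]
    exact zero_le_one

lemma lt_norm_sub_of_lt_rootTau {f : ℂ[X]} (hf : HasSimpleRoots f) {R : ℝ} (hR : 0 ≤ R)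
    (h : ENNReal.ofReal R < rootTau f) {w v : ℂ} (hw : f.IsRoot w)
    (hv : f.derivative.IsRoot v) : R < ‖w - v‖ := by
  have hne : v ≠ w := by
    rintro rfl
    exact hf.eval_derivative_ne_zero hw hv
  have : rootTau f ≤ ENNReal.ofReal ‖w - v‖ :=
    iInf₂_le_of_le w hw (iInf₂_le_of_le v ⟨hv, hne⟩ le_rfl)
  exact (ENNReal.ofReal_lt_ofReal_iff_of_nonneg hR).1 (h.trans_le this)

/-- The Taylor coefficients of `f'` at `w` are `(k + 1)` times those of `f`, so
those of `f` are bounded by the coefficient bound for `f'`. -/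
lemma norm_coeff_taylor_le_of_isRoot {f : ℂ[X]} {n : ℕ} (hn : f.natDegree ≤ n) {R : ℝ}
    (hR : 1 ≤ R) {w : ℂ} (h : ∀ v ∈ f.derivative.roots, R ≤ ‖w - v‖) {k : ℕ} (hk : 2 ≤ k) :
    ‖(taylor w f).coeff k‖ ≤ 2 ^ n / R * ‖(taylor w f).coeff 1‖ := by
  obtain ⟨j, rfl⟩ : ∃ j, k = j + 1 + 1 := ⟨k - 2, by omega⟩
  have hder : derivative (taylor w f) = taylor w (derivative f) := by
    simp [taylor_apply, derivative_comp]
  have h0 : 0 < R := by linarith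
  have h1 := norm_coeff_taylor_mul_pow_le h0.le w (derivative f) h (j + 1)
  rw [← hder, coeff_derivative, ← taylor_coeff_one] at h1
  have h2 : ((derivative f).natDegree.choose (j + 1) : ℝ) ≤ 2 ^ n := by
    have := (Nat.choose_le_two_pow (derivative f).natDegree (j + 1)).trans
      (Nat.pow_le_pow_right two_pos ((natDegree_derivative_le f).trans
        ((Nat.sub_le _ _).trans hn)))
    exact_mod_cast this
  have h3 : (1 : ℝ) ≤ ‖((j + 1 : ℕ) : ℂ) + 1‖ := by
    have : ((j + 1 : ℕ) : ℂ) + 1 = ((j + 1 + 1 : ℕ) : ℂ) := by push_cast; ring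
    rw [this, Complex.norm_natCast]
    exact_mod_cast Nat.le_add_left 1 (j + 1)
  rw [norm_mul] at h1
  rw [div_mul_eq_mul_div, le_div_iff₀ h0]
  calc ‖(taylor w f).coeff (j + 1 + 1)‖ * R
      ≤ ‖(taylor w f).coeff (j + 1 + 1)‖ * ‖((j + 1 : ℕ) : ℂ) + 1‖ * R ^ (j + 1) := by
        gcongr
        · exact le_mul_of_one_le_right (norm_nonneg _) h3
        · exact le_self_pow₀ hR (by omega)
    _ ≤ _ := h1
    _ ≤ _ := by gcongr

/-- A linear functional applied to a polynomial without constant term whose coefficients of degree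
at least `2` are small is close to its value on the linear term. -/
lemma norm_linearMap_sub_coeff_one_le (L : ℂ[X] →ₗ[ℂ] ℂ) {F : ℂ[X]} {n : ℕ} (hn : 1 ≤ n)
    (hF : F.natDegree ≤ n) (h0 : F.coeff 0 = 0) {η : ℝ}
    (hη : ∀ k, 2 ≤ k → ‖F.coeff k‖ ≤ η) :
    ‖L F - F.coeff 1 * L X‖ ≤ η * ∑ k ∈ Finset.Ico 2 (n + 1), ‖L (X ^ k)‖ := by
  have hL : L F = ∑ k ∈ Finset.range (n + 1), F.coeff k * L (X ^ k) := by
    conv_lhs => rw [F.as_sum_range_C_mul_X_pow' (Nat.lt_succ_of_le hF)]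
    rw [map_sum]
    refine Finset.sum_congr rfl fun k _ => ?_
    rw [← smul_eq_C_mul, map_smul, smul_eq_mul]
  rw [← Finset.sum_range_add_sum_Ico _ (show 2 ≤ n + 1 by omega), Finset.sum_range_succ,
    Finset.sum_range_one, h0, zero_mul, zero_add, pow_one] at hL
  rw [hL, add_sub_cancel_left, Finset.mul_sum]
  refine norm_sum_le_of_le _ fun k hk => ?_
  rw [norm_mul]
  gcongr
  exact hη k (Finset.mem_Ico.1 hk).1

/-- Near a root `w`, a polynomial whose higher Taylor coefficients at `w` are small compared to
the first has no other root. -/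
lemma lt_norm_sub_of_isRoot {f : ℂ[X]} {n : ℕ} (hn : 1 ≤ n) (hf : f.natDegree ≤ n) {w w' : ℂ}
    (hw : f.IsRoot w) (hw' : f.IsRoot w') (hne : w' ≠ w) {η r : ℝ} (hr : 0 ≤ r)
    (hη : ∀ k, 2 ≤ k → ‖(taylor w f).coeff k‖ ≤ η)
    (hlt : η * (n * (1 + r) ^ n) < ‖(taylor w f).coeff 1‖) : r < ‖w' - w‖ := by
  by_contra! H
  have hη0 : 0 ≤ η := (norm_nonneg _).trans (hη 2 le_rfl)
  have hz : 0 < ‖w' - w‖ := norm_pos_iff.2 (sub_ne_zero.2 hne)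
  have h := norm_linearMap_sub_coeff_one_le (leval (w' - w)) hn (F := taylor w f)
    (by rwa [natDegree_taylor]) (by rw [taylor_coeff_zero]; exact hw) hη
  simp only [leval_apply, taylor_eval, eval_X, eval_pow, sub_add_cancel, hw'.eq_zero,
    zero_sub, norm_neg, norm_mul, norm_pow] at h
  have hsum : ∑ k ∈ Finset.Ico 2 (n + 1), ‖w' - w‖ ^ k ≤ n * (1 + r) ^ n * ‖w' - w‖ := by
    have hle : ∀ k ∈ Finset.Ico 2 (n + 1), ‖w' - w‖ ^ k ≤ (1 + r) ^ n * ‖w' - w‖ := by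
      intro k hk
      rw [Finset.mem_Ico] at hk
      obtain ⟨j, rfl⟩ : ∃ j, k = j + 1 := ⟨k - 1, by omega⟩
      rw [pow_succ]
      gcongr
      calc ‖w' - w‖ ^ j ≤ (1 + r) ^ j := by gcongr; linarith
        _ ≤ (1 + r) ^ n := pow_le_pow_right₀ (by linarith) (by omega)
    refine (Finset.sum_le_card_nsmul _ _ _ hle).trans ?_
    rw [nsmul_eq_mul, mul_assoc, Nat.card_Ico]
    gcongr
    omega
  have h2 := h.trans (mul_le_mul_of_nonneg_left hsum hη0)
  rw [← mul_assoc] at h2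
  exact absurd (le_of_mul_le_mul_right h2 hz) (not_le.2 hlt)

/-! ### The differential operator -/

lemma diffOperator_apply (n : ℕ) (α : Fin (n + 1) → ℂ) (f : ℂ[X]) :
    diffOperator n α f = ∑ k : Fin (n + 1), α k • derivative^[k] f := by
  simp [diffOperator, LinearMap.sum_apply, Module.End.pow_apply]

lemma diffOperator_taylor (n : ℕ) (α : Fin (n + 1) → ℂ) (w : ℂ) (f : ℂ[X]) :
    diffOperator n α (taylor w f) = taylor w (diffOperator n α f) := by
  have hcomm : Function.Commute (derivative : ℂ[X] → ℂ[X]) (taylor w) := fun g => by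
    simp [taylor_apply, derivative_comp]
  simp_rw [diffOperator_apply, map_sum, map_smul]
  exact Finset.sum_congr rfl fun k _ => by rw [(hcomm.iterate_left k).eq f]

lemma diffOperator_X {n : ℕ} (hn : 1 ≤ n) (α : Fin (n + 1) → ℂ) :
    diffOperator n α X = C (α 0) * X + C (α 1) := by
  obtain ⟨m, rfl⟩ : ∃ m, n = m + 1 := ⟨n - 1, by omega⟩
  rw [diffOperator_apply, Fin.sum_univ_succ, Fin.sum_univ_succ, Finset.sum_eq_zero, add_zero]
  · simp [smul_eq_C_mul]
  · intro k _
    simp [Function.iterate_succ_apply]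

lemma natDegree_diffOperator_le (n : ℕ) (α : Fin (n + 1) → ℂ) (f : ℂ[X]) :
    (diffOperator n α f).natDegree ≤ f.natDegree := by
  rw [diffOperator_apply]
  refine natDegree_sum_le_of_forall_le _ _ fun k _ => (natDegree_smul_le _ _).trans ?_
  exact (natDegree_iterate_derivative f k).trans (Nat.sub_le _ _)

lemma diffOperator_ne_zero {n : ℕ} {α : Fin (n + 1) → ℂ} (hα : α 0 ≠ 0) {f : ℂ[X]}
    (hf : f ≠ 0) : diffOperator n α f ≠ 0 := by
  intro h
  have hc : (diffOperator n α f).coeff f.natDegree = α 0 * f.leadingCoeff := by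
    rw [diffOperator_apply, Fin.sum_univ_succ, coeff_add, finsetSum_coeff,
      Finset.sum_eq_zero, add_zero]
    · simp
    · intro k _
      rw [coeff_smul, coeff_iterate_derivative, coeff_eq_zero_of_natDegree_lt]
      · simp
      · simp
  rw [h, coeff_zero] at hc
  exact mul_ne_zero hα (leadingCoeff_ne_zero.2 hf) hc.symm

/-- If the higher Taylor coefficients of `f` at a root `w` are small compared to the first, then
`T f` has a root near `w - α₁ / α₀`: up to the factor `f'(w)` and a small error, `T f` is
`α₀ z + α₁` in the coordinate `z` centred at `w`. -/
lemma exists_isRoot_diffOperator_near {n : ℕ} (hn : 1 ≤ n) {α : Fin (n + 1) → ℂ} (hα : α 0 ≠ 0)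
    {f : ℂ[X]} (hf : f.natDegree ≤ n) {w : ℂ} (hw : f.IsRoot w) {η δ : ℝ} (hδ : 0 ≤ δ)
    (hη : ∀ k, 2 ≤ k → ‖(taylor w f).coeff k‖ ≤ η)
    (hlt : η * (n * ∑ k ∈ Finset.Ico 2 (n + 1),
        ‖(diffOperator n α (X ^ k)).eval (-(α 1 / α 0))‖ +
      δ * ∑ k ∈ Finset.Ico 2 (n + 1),
        ‖(derivative (diffOperator n α (X ^ k))).eval (-(α 1 / α 0))‖)
      < δ * (‖α 0‖ * ‖(taylor w f).coeff 1‖)) :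
    ∃ z, (diffOperator n α f).IsRoot z ∧ ‖w - α 1 / α 0 - z‖ < δ := by
  set b := -(α 1 / α 0) with hb
  set M₁ := ∑ k ∈ Finset.Ico 2 (n + 1), ‖(diffOperator n α (X ^ k)).eval b‖
  set M₂ := ∑ k ∈ Finset.Ico 2 (n + 1), ‖(derivative (diffOperator n α (X ^ k))).eval b‖
  set F := taylor w f with hF
  have hFn : F.natDegree ≤ n := by rwa [hF, natDegree_taylor]
  have hF0 : F.coeff 0 = 0 := by rw [hF, taylor_coeff_zero]; exact hw
  have h1 := norm_linearMap_sub_coeff_one_le (leval b ∘ₗ diffOperator n α) hn hFn hF0 hη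
  have h2 := norm_linearMap_sub_coeff_one_le (leval b ∘ₗ derivative ∘ₗ diffOperator n α) hn hFn
    hF0 hη
  simp only [LinearMap.comp_apply, leval_apply, diffOperator_X hn] at h1 h2
  -- `b` is the root of `T X = α₀ X + α₁`, whose derivative is `α₀`.
  have e1 : (C (α 0) * X + C (α 1)).eval b = 0 := by
    simp only [eval_add, eval_mul, eval_C, eval_X, hb]
    field_simp
    ring
  have e2 : (derivative (C (α 0) * X + C (α 1))).eval b = α 0 := by simp
  rw [e1, mul_zero, sub_zero] at h1
  rw [e2] at h2
  obtain ⟨z, hz, hzb⟩ := exists_isRoot_norm_sub_lt (p := diffOperator n α F) (a := b) hδ (by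
    have hdeg : ((diffOperator n α F).natDegree : ℝ) ≤ n := by
      exact_mod_cast (natDegree_diffOperator_le n α F).trans hFn
    have h3 : ‖F.coeff 1 * α 0‖ ≤ ‖(derivative (diffOperator n α F)).eval b‖ + η * M₂ := by
      have := norm_sub_norm_le (F.coeff 1 * α 0) ((derivative (diffOperator n α F)).eval b)
      rw [norm_sub_rev] at this
      linarith
    rw [norm_mul, mul_comm ‖F.coeff 1‖] at h3
    calc ((diffOperator n α F).natDegree : ℝ) * ‖(diffOperator n α F).eval b‖
        ≤ n * (η * M₁) := by gcongr
      _ < δ * (‖α 0‖ * ‖F.coeff 1‖ - η * M₂) := by linarith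
      _ ≤ _ := by gcongr; linarith)
  refine ⟨z + w, ?_, ?_⟩
  · rwa [hF, diffOperator_taylor, IsRoot, taylor_eval] at hz
  · rwa [show w - α 1 / α 0 - (z + w) = b - z by rw [hb]; ring]

/-! ### Matching the roots -/

lemma roots_taylor (r : ℂ) (f : ℂ[X]) : (taylor r f).roots = f.roots.map fun w => w - r := by
  have h := map_roots_comp_C_mul_X_add_C f 1 r isUnit_one
  rw [C_1, one_mul, ← taylor_apply] at h
  rw [← h, Multiset.map_map]
  simp

/-- Distinct points `v i`, as many as the degree, that are roots of `g` are all its roots. -/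
lemma map_univ_eq_roots {m : ℕ} {g : ℂ[X]} (hg : g ≠ 0) (hm : g.natDegree ≤ m) {v : Fin m → ℂ}
    (hv : Function.Injective v) (hroot : ∀ i, g.IsRoot (v i)) :
    (Finset.univ : Finset (Fin m)).val.map v = g.roots := by
  refine Multiset.eq_of_le_of_card_le
    ((Multiset.le_iff_subset (Finset.univ.nodup.map hv)).2 fun z hz => ?_) ?_
  · obtain ⟨i, _, rfl⟩ := Multiset.mem_map.1 hz
    exact (mem_roots hg).2 (hroot i)
  · simpa using (card_roots' g).trans hm

lemma frechetDist_map_univ_le {m : ℕ} (u v : Fin m → ℂ) {δ : ℝ} (h : ∀ i, ‖u i - v i‖ ≤ δ) :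
    frechetDist ((Finset.univ : Finset (Fin m)).val.map u)
      ((Finset.univ : Finset (Fin m)).val.map v) ≤ ENNReal.ofReal δ := by
  refine iInf_le_of_le m (iInf_le_of_le u (iInf_le_of_le v (iInf_le_of_le rfl
    (iInf_le_of_le rfl ?_))))
  refine iInf_le_of_le (Equiv.refl _) (iSup_le fun i => ?_)
  exact ENNReal.ofReal_le_ofReal (h i)

theorem mainTheorem1 (n : ℕ) (hn : 1 ≤ n) (α : Fin (n + 1) → ℂ) (hα : α 0 ≠ 0)
    (ε : ℝ) (hε : 0 < ε) :
    ∃ C : ℝ, 0 < C ∧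
      ∀ f ∈ Polynomial.degreeLE ℂ (n : WithBot ℕ), HasSimpleRoots f →
        ENNReal.ofReal C < rootTau f →
          frechetDist (Polynomial.taylor (α 1 / α 0) f).roots (diffOperator n α f).roots
            < ENNReal.ofReal ε := by
  set M₁ := ∑ k ∈ Finset.Ico 2 (n + 1), ‖(diffOperator n α (X ^ k)).eval (-(α 1 / α 0))‖
    with hM₁
  set M₂ := ∑ k ∈ Finset.Ico 2 (n + 1),
    ‖(derivative (diffOperator n α (X ^ k))).eval (-(α 1 / α 0))‖ with hM₂
  have hM₁0 : 0 ≤ M₁ := Finset.sum_nonneg fun _ _ => norm_nonneg _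
  have hM₂0 : 0 ≤ M₂ := Finset.sum_nonneg fun _ _ => norm_nonneg _
  have hα0 : 0 < ‖α 0‖ := norm_pos_iff.2 hα
  set δ := ε / 2 with hδ
  have hδ0 : 0 < δ := half_pos hε
  set A := (n * M₁ + δ * M₂) / (δ * ‖α 0‖)
  set B := (n : ℝ) * (1 + ε) ^ n
  have hA0 : 0 ≤ A := by positivity
  have hB0 : 0 ≤ B := by positivity
  -- The summand with `A` produces the roots of `T f`, the one with `B` separates them.
  set R := 1 + 2 ^ n * (A + B) with hRdef
  have hR1 : 1 ≤ R := by
    have : 0 ≤ 2 ^ n * (A + B) := by positivity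
    linarith
  have hR0 : 0 < R := by linarith
  refine ⟨R, hR0, fun f hfn hf hτ => ?_⟩
  have hfdeg : f.natDegree ≤ n := natDegree_le_iff_degree_le.2 (mem_degreeLE.1 hfn)
  have hη {w : ℂ} (hw : f.IsRoot w) (k : ℕ) (hk : 2 ≤ k) : ‖(taylor w f).coeff k‖ ≤
      2 ^ n / R * ‖(taylor w f).coeff 1‖ :=
    norm_coeff_taylor_le_of_isRoot hfdeg hR1 (fun v hv =>
      (lt_norm_sub_of_lt_rootTau hf hR0.le hτ hw (isRoot_of_mem_roots hv)).le) hk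
  have hpos {w : ℂ} (hw : f.IsRoot w) : 0 < ‖(taylor w f).coeff 1‖ := by
    rw [taylor_coeff_one]
    exact norm_pos_iff.2 (hf.eval_derivative_ne_zero hw)
  have hsmall {Q : ℝ} (hQ : Q ≤ A + B) : 2 ^ n / R * Q < 1 := by
    rw [div_mul_eq_mul_div, div_lt_one hR0, hRdef]
    have : (2 : ℝ) ^ n * Q ≤ 2 ^ n * (A + B) := by gcongr
    linarith
  have hsep {w w' : ℂ} (hw : f.IsRoot w) (hw' : f.IsRoot w') (hne : w' ≠ w) :
      ε < ‖w' - w‖ := by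
    refine lt_norm_sub_of_isRoot hn hfdeg hw hw' hne hε.le (hη hw) ?_
    have := mul_lt_mul_of_pos_right (hsmall (show B ≤ A + B by linarith)) (hpos hw)
    rw [one_mul] at this
    linarith
  have hnear {w : ℂ} (hw : f.IsRoot w) :
      ∃ z, (diffOperator n α f).IsRoot z ∧ ‖w - α 1 / α 0 - z‖ < δ := by
    refine exists_isRoot_diffOperator_near hn hα hfdeg hw hδ0.le (hη hw) ?_
    have h1 := mul_lt_mul_of_pos_right (hsmall (show A ≤ A + B by linarith))
      (show 0 < δ * ‖α 0‖ * ‖(taylor w f).coeff 1‖ from mul_pos (by positivity) (hpos hw))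
    have h2 : A * (δ * ‖α 0‖) = n * M₁ + δ * M₂ := div_mul_cancel₀ _ (by positivity)
    rw [← hM₁, ← hM₂, ← h2]
    linarith
  -- An enumeration `u` of the roots of `f`.
  obtain ⟨u, hu⟩ : ∃ u : Fin f.natDegree → ℂ,
      (Finset.univ : Finset (Fin f.natDegree)).val.map u = f.roots := by
    rw [← IsAlgClosed.card_roots_eq_natDegree (p := f)]
    induction f.roots using Quotient.inductionOn with
    | _ l => exact ⟨l.get, (Fin.univ_val_map _).trans (congrArg _ (List.ofFn_get l))⟩
  have huroot (i) : f.IsRoot (u i) := by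
    refine isRoot_of_mem_roots ?_
    rw [← hu]
    exact Multiset.mem_map_of_mem u (Finset.mem_univ i)
  have huinj : Function.Injective u := by
    have := hf.nodup_roots
    rw [← hu] at this
    exact fun i j hij => Multiset.inj_on_of_nodup_map this i (Finset.mem_univ i) j
      (Finset.mem_univ j) hij
  choose v hvroot hv using fun i => hnear (huroot i)
  have hvinj : Function.Injective v := by
    intro i j hij
    by_contra hne
    have h1 := hsep (huroot i) (huroot j) fun h => hne (huinj h.symm)
    have h2 := hv i
    have h3 := hv j
    rw [hij, norm_sub_rev] at h2
    have h4 := norm_add_le (u j - α 1 / α 0 - v j) (v j - (u i - α 1 / α 0))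
    rw [show u j - α 1 / α 0 - v j + (v j - (u i - α 1 / α 0)) = u j - u i by ring] at h4
    linarith
  rw [roots_taylor, ← hu, Multiset.map_map, ← map_univ_eq_roots (diffOperator_ne_zero hα hf.ne_zero)
    (natDegree_diffOperator_le n α f) hvinj hvroot]
  exact (frechetDist_map_univ_le _ v fun i => (hv i).le).trans_lt
    ((ENNReal.ofReal_lt_ofReal_iff hε).2 (half_lt_self hε))
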